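/- Let $d\ge 1$. A function $f:\mathbb R^d\to\mathbb R$ is called DC if it is the difference of two convex functions on $\mathbb R^d$; such a function is locally Lipschitz. Its Clarke subgradient $\partial f(x)$ at $x\in\mathbb R^d$ is the closed convex hull of the set of all limits $\lim_{i\to\infty}\nabla f(x_i)$, where $x_i\to x$ and $f$ is differentiable at each $x_i$. The number $0$ is called a weakly regular value of $f$ if, whenever $x_i\to x$, $f(x_i)>0=f(x)$ and $u_i\in\partial f(x_i)$ for all $i\in\mathbb N$, we have $\liminf_{i\to\infty}|u_i|>0$. A set $M\subset\mathbb R^d$ is called WDC if there is a DC function $f:\mathbb R^d\to[0,\infty)$ such that $M=f^{-1}\{0\}$ and $0$ is a weakly regular value of $f$. A mapping $\varphi:W\to V$ between finite-dimensional normed spaces is called DC if $\ell\circ\varphi$ is a difference of two convex functions on $W$ for every linear functional $\ell$ on $V$. A DC hypersurface in $\mathbb R^d$ is a set of the form $\{w+\varphi(w):\ w\in W\}$, where $W\subset\mathbb R^d$ is a $(d-1)$-dimensional linear subspace and $\varphi:W\to W^{\perp}$ is a Lipschitz DC mapping (for $d=1$, the DC hypersurfaces are the singletons). Proposition. If $M\subset\mathbb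 R^d$ is a compact WDC set, then its boundary $\partial M$ is contained in the union of finitely many DC hypersurfaces. -/

import Mathlib

open Filter Topology

/-- A real function on a normed space is DC if it is a difference of two convex functions. -/
def IsDCFunction {E : Type*} [NormedAddCommGroup E] [NormedSpace ℝ E] (f : E → ℝ) : Prop :=
  ∃ g h : E → ℝ, ConvexOn ℝ Set.univ g ∧ ConvexOn ℝ Set.univ h ∧ ∀ x, f x = g x - h x

/-- A mapping is DC if its composition with every continuous linear functional is DC. -/
def IsDCMapping {E F : Type*} [NormedAddCommGroup E] [NormedSpace ℝ E]
    [NormedAddCommGroup F] [NormedSpace ℝ F] (φ : E → F) : Prop :=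
  ∀ l : F →L[ℝ] ℝ, IsDCFunction (fun x => l (φ x))

/-- The Clarke subgradient of `f` at `x` (for locally Lipschitz `f`, in a finite-dimensional
Hilbert space): the closed convex hull of all limits of gradients of `f` at points of
differentiability converging to `x`. -/
def clarkeSubgradient {E : Type*} [NormedAddCommGroup E] [InnerProductSpace ℝ E]
    [CompleteSpace E] (f : E → ℝ) (x : E) : Set E :=
  closure (convexHull ℝ {v : E | ∃ y : ℕ → E, (∀ i, DifferentiableAt ℝ f (y i)) ∧
    Tendsto y atTop (𝓝 x) ∧ Tendsto (fun i => gradient f (y i)) atTop (𝓝 v)})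

/-- `c` is a weakly regular value of the (locally Lipschitz) function `f`: whenever `x i → x`,
`f (x i) > c = f x` and `u i ∈ ∂f (x i)` for all `i`, then `liminf |u i| > 0`. The lower limit
is taken in `[0, ∞]`. -/
def IsWeaklyRegularValue {E : Type*} [NormedAddCommGroup E] [InnerProductSpace ℝ E]
    [CompleteSpace E] (f : E → ℝ) (c : ℝ) : Prop :=
  ∀ (x : E) (y u : ℕ → E), Tendsto y atTop (𝓝 x) → (∀ i, c < f (y i)) → f x = c →
    (∀ i, u i ∈ clarkeSubgradient f (y i)) → 0 < liminf (fun i => ‖u i‖ₑ) atTop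

/-- `f` is a DC aura for `A`: a nonnegative DC function with zero set `A`, for which `0` is a
weakly regular value. (In finite dimension, DC functions are locally Lipschitz.) -/
def IsDCAura {E : Type*} [NormedAddCommGroup E] [InnerProductSpace ℝ E]
    [CompleteSpace E] (f : E → ℝ) (A : Set E) : Prop :=
  IsDCFunction f ∧ (∀ x, 0 ≤ f x) ∧ A = f ⁻¹' {0} ∧ IsWeaklyRegularValue f 0

/-- A set is WDC if it has a DC aura. -/
def IsWDC {E : Type*} [NormedAddCommGroup E] [InnerProductSpace ℝ E]
    [CompleteSpace E] (A : Set E) : Prop :=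
  ∃ f : E → ℝ, IsDCAura f A

/-- A DC surface of dimension `k`: the set of all `w + φ w`, `w ∈ W`, where `W` is a
`k`-dimensional linear subspace and `φ : W → Wᗮ` is a Lipschitz DC mapping. For `k = 0` these are
exactly the singletons, and for `k` the full dimension exactly the whole space. -/
def IsDCSurface {E : Type*} [NormedAddCommGroup E] [InnerProductSpace ℝ E]
    (k : ℕ) (A : Set E) : Prop :=
  ∃ W : Submodule ℝ E, Module.finrank ℝ W = k ∧ ∃ φ : W → Wᗮ,
    (∃ K, LipschitzWith K φ) ∧ IsDCMapping φ ∧ A = {x : E | ∃ w : W, x = (w : E) + (φ w : E)}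

/-- A DC hypersurface: a DC surface of codimension one. -/
def IsDCHypersurface {E : Type*} [NormedAddCommGroup E] [InnerProductSpace ℝ E]
    (A : Set E) : Prop :=
  ∃ k : ℕ, k + 1 = Module.finrank ℝ E ∧ IsDCSurface k A

/-! The boundary of a compact WDC set is covered by finitely many DC hypersurfaces.

Write the aura as `f = g - h` with `g`, `h` convex. Weak regularity bounds the gradients of `f` on
`{f > 0}` below by some `ε > 0` near any given point of `M`. By Rademacher's theorem a boundary
point `x` is a limit of points of `{f > 0}` at which `g` and `h` are differentiable, and limits
`p`, `q` of `∇ g`, `∇ h` along a subsequence are subgradients of `g`, `h` at `x` with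
`ε ≤ ‖p - q‖`. Since `f ≥ 0 = f x`, the subgradient `q` of `h` is also one of `g`. Hence near any
point of `M` the boundary consists of points at which the single convex function `g` has two
bounded subgradients at distance at least `ε` (`exists_distant_subgradients`).

Such points are finitely covered (`isFinitelyDCCovered_setOf_distant_subgradients`): by
compactness of the set of pairs `(p, q)` one may fix a unit vector `e` and levels `a < b` with
`⟪p, e⟫ ≤ a` and `b ≤ ⟪q, e⟫`. By convexity of the subdifferential there are then subgradients
`r` with `⟪r, e⟫ = c` for `c = a` and for `c = b`. Let `G c` be the supremum of the affine minorants
of `g` with bounded slope `r`, `⟪r, e⟫ = c`, minus `c ⟪e, ·⟫`. It is convex, Lipschitz and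
invariant along `e`, and `G c x = g x - c ⟪e, x⟫`. Subtracting the two equations gives
`⟪e, x⟫ = (G a x - G b x) / (b - a)`, so `x` lies on the graph of an explicit Lipschitz DC function
on the hyperplane orthogonal to `e` (`exists_isDCHypersurface_of_separated_subgradients`). -/

section DCCovering

open MeasureTheory

variable {E : Type*} [NormedAddCommGroup E] [InnerProductSpace ℝ E]

/-! ### Subgradients of convex functions -/

/-- The subdifferential of `g` at `x` in the sense of convex analysis: the slopes of the affine
functions that lie below `g` everywhere and touch it at `x`. -/
def convexSubdifferential (g : E → ℝ) (x : E) : Set E :=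
  {p | ∀ y, g x + inner ℝ p (y - x) ≤ g y}

theorem convex_convexSubdifferential (g : E → ℝ) (x : E) :
    Convex ℝ (convexSubdifferential g x) := by
  intro p hp q hq s t hs ht hst y
  have h1 := mul_le_mul_of_nonneg_left (hp y) hs
  have h2 := mul_le_mul_of_nonneg_left (hq y) ht
  rw [inner_add_left, real_inner_smul_left, real_inner_smul_left]
  have h3 : g x = s * g x + t * g x := by rw [← add_mul, hst, one_mul]
  have h4 : g y = s * g y + t * g y := by rw [← add_mul, hst, one_mul]
  linarith

theorem ConvexOn.gradient_mem_convexSubdifferential [CompleteSpace E] {g : E → ℝ}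
    (hg : ConvexOn ℝ Set.univ g) {x : E} (hx : DifferentiableAt ℝ g x) :
    gradient g x ∈ convexSubdifferential g x := by
  intro y
  have hline : ConvexOn ℝ Set.univ (g ∘ (AffineMap.lineMap x y : ℝ →ᵃ[ℝ] E)) := by
    simpa using hg.comp_affineMap (AffineMap.lineMap x y : ℝ →ᵃ[ℝ] E)
  have hderiv : HasDerivAt (g ∘ (AffineMap.lineMap x y : ℝ →ᵃ[ℝ] E)) (fderiv ℝ g x (y - x)) 0 := by
    have h0 : HasFDerivAt g (fderiv ℝ g x) ((AffineMap.lineMap x y : ℝ →ᵃ[ℝ] E) 0) := by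
      simpa using hx.hasFDerivAt
    exact h0.comp_hasDerivAt (0 : ℝ) AffineMap.hasDerivAt_lineMap
  have h := hline.le_slope_of_hasDerivAt (Set.mem_univ 0) (Set.mem_univ 1) one_pos hderiv
  have hinner : inner ℝ (gradient g x) (y - x) = fderiv ℝ g x (y - x) := by
    simp [gradient]
  rw [hinner]
  simp only [slope_def_field, Function.comp_apply, AffineMap.lineMap_apply_zero,
    AffineMap.lineMap_apply_one, sub_zero, div_one] at h
  linarith

theorem mem_convexSubdifferential_of_tendsto {g : E → ℝ} {x p : E} {y r : ℕ → E}
    (hg : ContinuousAt g x) (hy : Tendsto y atTop (𝓝 x)) (hr : Tendsto r atTop (𝓝 p))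
    (hmem : ∀ n, r n ∈ convexSubdifferential g (y n)) : p ∈ convexSubdifferential g x := fun z =>
  le_of_tendsto ((hg.tendsto.comp hy).add (hr.inner (tendsto_const_nhds.sub hy)))
    (Eventually.of_forall fun n => hmem n z)

/-- If `g - h` attains its minimum at `x`, every subgradient of `h` is one of `g`. -/
theorem convexSubdifferential_subset_of_sub_min {g h : E → ℝ} {x : E}
    (hmin : ∀ y, g x - h x ≤ g y - h y) :
    convexSubdifferential h x ⊆ convexSubdifferential g x := by
  intro q hq y
  have := hq y
  have := hmin y
  linarith

theorem exists_mem_convexSubdifferential_inner_eq {g : E → ℝ} {x p q e : E} {L c : ℝ}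
    (hp : p ∈ convexSubdifferential g x) (hq : q ∈ convexSubdifferential g x)
    (hpL : ‖p‖ ≤ L) (hqL : ‖q‖ ≤ L) (hpc : inner ℝ p e ≤ c) (hcq : c ≤ inner ℝ q e) :
    ∃ r ∈ convexSubdifferential g x, ‖r‖ ≤ L ∧ inner ℝ r e = c := by
  have hconv : Convex ℝ (convexSubdifferential g x ∩ Metric.closedBall 0 L) :=
    (convex_convexSubdifferential g x).inter (convex_closedBall 0 L)
  -- The functional `⟪·, e⟫` maps the convex set of bounded subgradients onto an interval.
  have himage : (fun r : E => inner ℝ r e) ''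
      (convexSubdifferential g x ∩ Metric.closedBall 0 L) |>.OrdConnected :=
    (hconv.isPreconnected.image _ (by fun_prop)).ordConnected
  obtain ⟨r, ⟨hr, hrL⟩, hrc⟩ := himage.out ⟨p, ⟨hp, by simpa using hpL⟩, rfl⟩
    ⟨q, ⟨hq, by simpa using hqL⟩, rfl⟩ ⟨hpc, hcq⟩
  exact ⟨r, hr, by simpa using hrL, hrc⟩

/-! ### Points where two subgradients are separated in a given direction -/

/-- For a unit vector `e`, the supremum of the affine minorants of `g` whose slopes `r` are bounded
by `L` and satisfy `⟪r, e⟫ = c`, minus `c ⟪e, ·⟫`, is convex, Lipschitz, and constant in the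
direction `e`. At a contact point `z` of one of these minorants the supremum equals `g z`. -/
theorem exists_convex_lipschitz_eq_sub_inner (g : E → ℝ) {e : E} (he : ‖e‖ = 1) (L c : ℝ) :
    ∃ G : E → ℝ, ConvexOn ℝ Set.univ G ∧ (∃ K, LipschitzWith K G) ∧
      ∀ z, ∀ r ∈ convexSubdifferential g z, ‖r‖ ≤ L → inner ℝ r e = c →
        ∀ s : ℝ, G (z + s • e) = g z - c * inner ℝ e z := by
  let I := {zr : E × E // zr.2 ∈ convexSubdifferential g zr.1 ∧ ‖zr.2‖ ≤ L ∧
    inner ℝ zr.2 e = c}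
  let A : I → E → ℝ := fun i x => g i.1.1 + inner ℝ i.1.2 (x - i.1.1) - c * inner ℝ e x
  -- Without any such minorant the contact condition is vacuous and every `G` will do.
  rcases isEmpty_or_nonempty I with hI | hI
  · exact ⟨fun _ => 0, convexOn_const 0 convex_univ, ⟨0, LipschitzWith.const 0⟩,
      fun z r hr hL hc => hI.elim ⟨(z, r), hr, hL, hc⟩⟩
  have hbound : ∀ x i, A i x ≤ g x - c * inner ℝ e x := fun x i =>
    sub_le_sub_right (i.2.1 x) _
  have hbdd : ∀ x, BddAbove (Set.range fun i => A i x) := fun x =>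
    ⟨g x - c * inner ℝ e x, by rintro _ ⟨i, rfl⟩; exact hbound x i⟩
  refine ⟨fun x => ⨆ i, A i x, ⟨convex_univ, ?_⟩, ⟨(L + |c|).toNNReal, ?_⟩, ?_⟩
  · intro x _ y _ s t hs ht hst
    refine ciSup_le fun i => ?_
    have hx := mul_le_mul_of_nonneg_left (le_ciSup (hbdd x) i) hs
    have hy := mul_le_mul_of_nonneg_left (le_ciSup (hbdd y) i) ht
    have hA : A i (s • x + t • y) = s * A i x + t * A i y := by
      obtain rfl : t = 1 - s := by linarith
      simp only [A, inner_sub_right, inner_add_right, real_inner_smul_right]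
      ring
    rw [hA]
    exact add_le_add hx hy
  · refine LipschitzWith.of_le_add_mul _ fun x y => ciSup_le fun i => ?_
    have hA : A i x = A i y + inner ℝ (i.1.2 - c • e) (x - y) := by
      simp only [A, inner_sub_right, inner_sub_left, real_inner_smul_left]
      ring
    have hnorm : ‖i.1.2 - c • e‖ ≤ L + |c| := by
      refine (norm_sub_le _ _).trans (add_le_add i.2.2.1 ?_)
      rw [norm_smul, he, mul_one, Real.norm_eq_abs]
    have hinner : inner ℝ (i.1.2 - c • e) (x - y) ≤ (L + |c|) * dist x y := by
      rw [dist_eq_norm]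
      exact (real_inner_le_norm _ _).trans (mul_le_mul_of_nonneg_right hnorm (norm_nonneg _))
    have hcoe := mul_le_mul_of_nonneg_right (Real.le_coe_toNNReal (L + |c|))
      (dist_nonneg (x := x) (y := y))
    have := le_ciSup (hbdd y) i
    linarith
  · intro z r hr hL hc s
    have hee : inner ℝ e e = (1 : ℝ) := by rw [real_inner_self_eq_norm_sq, he, one_pow]
    have hinv : ∀ i, A i (z + s • e) = A i z := by
      intro i
      have hi : inner ℝ i.1.2 e = c := i.2.2.2
      simp only [A, inner_sub_right, inner_add_right, real_inner_smul_right, hi, hee]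
      ring
    simp only [hinv]
    refine le_antisymm (ciSup_le (hbound z)) ?_
    refine le_trans (le_of_eq ?_) (le_ciSup (hbdd z) ⟨(z, r), hr, hL, hc⟩)
    simp [A]

theorem ConvexOn.isDCFunction_const_mul_sub {F : Type*} [NormedAddCommGroup F] [NormedSpace ℝ F]
    {g h : F → ℝ} (hg : ConvexOn ℝ Set.univ g) (hh : ConvexOn ℝ Set.univ h) (c : ℝ) :
    IsDCFunction fun x => c * (g x - h x) := by
  rcases le_total 0 c with hc | hc
  · exact ⟨_, _, hg.smul hc, hh.smul hc, fun x => by simp only [smul_eq_mul]; ring⟩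
  · exact ⟨_, _, hh.smul (neg_nonneg.2 hc), hg.smul (neg_nonneg.2 hc),
      fun x => by simp only [smul_eq_mul]; ring⟩

/-- The points at which `g` has two bounded subgradients separated by the levels `a < b` in the
direction `e` lie on the graph, over the hyperplane orthogonal to `e`, of the function
`(G a - G b) / (b - a)`, where `G c` is the marginal function of
`exists_convex_lipschitz_eq_sub_inner`. -/
theorem exists_isDCHypersurface_of_separated_subgradients [FiniteDimensional ℝ E] (g : E → ℝ)
    {e : E} (he : ‖e‖ = 1) (L : ℝ) {a b : ℝ} (hab : a < b) :
    ∃ P : Set E, IsDCHypersurface P ∧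
      {x | ∃ p ∈ convexSubdifferential g x, ∃ q ∈ convexSubdifferential g x, ‖p‖ ≤ L ∧ ‖q‖ ≤ L ∧
        inner ℝ p e ≤ a ∧ b ≤ inner ℝ q e} ⊆ P := by
  obtain ⟨Ga, hGa, ⟨Ka, hKa⟩, hGa_eq⟩ := exists_convex_lipschitz_eq_sub_inner g he L a
  obtain ⟨Gb, hGb, ⟨Kb, hKb⟩, hGb_eq⟩ := exists_convex_lipschitz_eq_sub_inner g he L b
  have he0 : e ≠ 0 := fun h => by simp [h] at he
  have hee : inner ℝ e e = (1 : ℝ) := by rw [real_inner_self_eq_norm_sq, he, one_pow]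
  let W : Submodule ℝ E := (ℝ ∙ e)ᗮ
  let e' : Wᗮ := ⟨e, Submodule.le_orthogonal_orthogonal _ (Submodule.mem_span_singleton_self e)⟩
  let φ : W → Wᗮ := fun w => ((b - a)⁻¹ * (Ga w - Gb w)) • e'
  have hdim : Module.finrank ℝ E = (Module.finrank ℝ E - 1) + 1 := by
    have : Nontrivial E := ⟨e, 0, he0⟩
    have := Module.finrank_pos (R := ℝ) (M := E)
    omega
  have : Fact (Module.finrank ℝ E = (Module.finrank ℝ E - 1) + 1) := ⟨hdim⟩
  refine ⟨_, ⟨Module.finrank ℝ E - 1, hdim.symm, W, Submodule.finrank_orthogonal_span_singleton he0,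
    φ, ?_, ?_, rfl⟩, ?_⟩
  · have hlip := (hKa.comp W.subtypeL.lipschitz).sub (hKb.comp W.subtypeL.lipschitz)
    have hφ : φ = fun w => ContinuousLinearMap.toSpanSingleton ℝ ((b - a)⁻¹ • e')
        (Ga (W.subtypeL w) - Gb (W.subtypeL w)) := by
      funext w
      simp only [φ, ContinuousLinearMap.toSpanSingleton_apply, smul_smul, Submodule.subtypeL_apply]
      rw [mul_comm]
    rw [hφ]
    exact ⟨_, (ContinuousLinearMap.toSpanSingleton ℝ ((b - a)⁻¹ • e')).lipschitz.comp hlip⟩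
  · intro l
    have h := ConvexOn.isDCFunction_const_mul_sub (hGa.comp_linearMap W.subtype)
      (hGb.comp_linearMap W.subtype) ((b - a)⁻¹ * l e')
    convert h using 2 with w
    simp only [φ, map_smul, smul_eq_mul, Function.comp_apply, Submodule.subtype_apply]
    ring
  · rintro x ⟨p, hp, q, hq, hpL, hqL, hpa, hbq⟩
    obtain ⟨ra, hra, hraL, hrae⟩ := exists_mem_convexSubdifferential_inner_eq hp hq hpL hqL hpa
      (hab.le.trans hbq)
    obtain ⟨rb, hrb, hrbL, hrbe⟩ := exists_mem_convexSubdifferential_inner_eq hp hq hpL hqL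
      (hpa.trans hab.le) hbq
    -- The orthogonal projection of `x` onto the hyperplane, a point of the line `x + ℝ e`.
    have hw : x + (-inner ℝ e x) • e ∈ W := by
      rw [Submodule.mem_orthogonal_singleton_iff_inner_right, inner_add_right,
        real_inner_smul_right, hee]
      ring
    refine ⟨⟨_, hw⟩, ?_⟩
    have hba : b - a ≠ 0 := (sub_pos.2 hab).ne'
    have hφ : (b - a)⁻¹ * (Ga (x + (-inner ℝ e x) • e) - Gb (x + (-inner ℝ e x) • e)) =
        inner ℝ e x := by
      rw [hGa_eq x ra hra hraL hrae, hGb_eq x rb hrb hrbL hrbe]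
      field_simp
      ring
    simp only [φ, hφ, e', Submodule.coe_smul]
    module

/-! ### Finite coverings by DC hypersurfaces -/

/-- A set is contained in the union of finitely many DC hypersurfaces. -/
def IsFinitelyDCCovered (A : Set E) : Prop :=
  ∃ S : Set (Set E), S.Finite ∧ (∀ P ∈ S, IsDCHypersurface P) ∧ A ⊆ ⋃₀ S

theorem isFinitelyDCCovered_empty : IsFinitelyDCCovered (∅ : Set E) :=
  ⟨∅, Set.finite_empty, by simp, Set.empty_subset _⟩

theorem IsFinitelyDCCovered.mono {A B : Set E} (hB : IsFinitelyDCCovered B) (hAB : A ⊆ B) :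
    IsFinitelyDCCovered A :=
  let ⟨S, hS, hP, hBS⟩ := hB
  ⟨S, hS, hP, hAB.trans hBS⟩

theorem IsFinitelyDCCovered.union {A B : Set E} (hA : IsFinitelyDCCovered A)
    (hB : IsFinitelyDCCovered B) : IsFinitelyDCCovered (A ∪ B) := by
  obtain ⟨S, hS, hSP, hAS⟩ := hA
  obtain ⟨T, hT, hTP, hBT⟩ := hB
  refine ⟨S ∪ T, hS.union hT, fun P hP => hP.elim (hSP P) (hTP P), ?_⟩
  rw [Set.sUnion_union]
  exact Set.union_subset_union hAS hBT

theorem IsDCHypersurface.isFinitelyDCCovered {P : Set E} (hP : IsDCHypersurface P) :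
    IsFinitelyDCCovered P :=
  ⟨{P}, Set.finite_singleton P, by simpa using hP, by simp⟩

/-- The points with two bounded subgradients at distance at least `ε` are covered by finitely many
DC hypersurfaces: each pair of distinct slopes is separated by two levels in some direction, this
direction and these levels serve a neighbourhood of the pair, and the pairs in question form a
compact set. -/
theorem isFinitelyDCCovered_setOf_distant_subgradients [FiniteDimensional ℝ E] (g : E → ℝ)
    (L : ℝ) {ε : ℝ} (hε : 0 < ε) :
    IsFinitelyDCCovered {x | ∃ p ∈ convexSubdifferential g x, ∃ q ∈ convexSubdifferential g x,
      ‖p‖ ≤ L ∧ ‖q‖ ≤ L ∧ ε ≤ ‖p - q‖} := by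
  let K : Set (E × E) := (Metric.closedBall 0 L ×ˢ Metric.closedBall 0 L) ∩
    {pq | ε ≤ ‖pq.1 - pq.2‖}
  have hK : IsCompact K :=
    ((isCompact_closedBall 0 L).prod (isCompact_closedBall 0 L)).inter_right
      (isClosed_le continuous_const (by fun_prop))
  have hcov : IsFinitelyDCCovered {x | ∃ pq ∈ K, pq.1 ∈ convexSubdifferential g x ∧
      pq.2 ∈ convexSubdifferential g x ∧ ‖pq.1‖ ≤ L ∧ ‖pq.2‖ ≤ L} := by
    refine hK.induction_on
      (p := fun s => IsFinitelyDCCovered {x | ∃ pq ∈ s, pq.1 ∈ convexSubdifferential g x ∧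
        pq.2 ∈ convexSubdifferential g x ∧ ‖pq.1‖ ≤ L ∧ ‖pq.2‖ ≤ L}) ?_ ?_ ?_ ?_
    · exact isFinitelyDCCovered_empty.mono (by rintro x ⟨pq, h, -⟩; exact h)
    · exact fun s t hst ht => ht.mono fun x ⟨pq, h, h'⟩ => ⟨pq, hst h, h'⟩
    · refine fun s t hs ht => (hs.union ht).mono ?_
      rintro x ⟨pq, h | h, h'⟩
      exacts [Or.inl ⟨pq, h, h'⟩, Or.inr ⟨pq, h, h'⟩]
    · rintro ⟨p, q⟩ ⟨-, hpq⟩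
      have hqp : 0 < ‖q - p‖ := by rw [norm_sub_rev]; exact hε.trans_le hpq
      let e : E := ‖q - p‖⁻¹ • (q - p)
      have he : ‖e‖ = 1 := by
        rw [norm_smul, norm_inv, norm_norm, inv_mul_cancel₀ hqp.ne']
      have hlt : inner ℝ p e < inner ℝ q e := by
        rw [← sub_pos, ← inner_sub_left, real_inner_smul_right, real_inner_self_eq_norm_sq]
        positivity
      obtain ⟨b, hb, hbq⟩ := exists_between hlt
      obtain ⟨a, hpa, hab⟩ := exists_between hb
      obtain ⟨P, hP, hsub⟩ := exists_isDCHypersurface_of_separated_subgradients g he L hab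
      refine ⟨{pq | inner ℝ pq.1 e < a ∧ b < inner ℝ pq.2 e}, mem_nhdsWithin_of_mem_nhds ?_,
        hP.isFinitelyDCCovered.mono ?_⟩
      · have h1 : IsOpen {pq : E × E | inner ℝ pq.1 e < a} :=
          isOpen_lt (by fun_prop) continuous_const
        have h2 : IsOpen {pq : E × E | b < inner ℝ pq.2 e} :=
          isOpen_lt continuous_const (by fun_prop)
        exact (h1.inter h2).mem_nhds ⟨hpa, hbq⟩
      · rintro x ⟨pq, ⟨h1, h2⟩, h3, h4, h5, h6⟩
        exact hsub ⟨pq.1, h3, pq.2, h4, h5, h6, h1.le, h2.le⟩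
  refine hcov.mono ?_
  rintro x ⟨p, hp, q, hq, hpL, hqL, hpq⟩
  exact ⟨(p, q), ⟨⟨by simpa using hpL, by simpa using hqL⟩, hpq⟩, hp, hq, hpL, hqL⟩

/-! ### Boundary points of the zero set of a DC aura -/

theorem LocallyLipschitz.ae_differentiableAt [FiniteDimensional ℝ E] [MeasurableSpace E]
    [BorelSpace E] {f : E → ℝ} (hf : LocallyLipschitz f) (μ : Measure E) [μ.IsAddHaarMeasure] :
    ∀ᵐ x ∂μ, DifferentiableAt ℝ f x := by
  refine measure_null_of_locally_null _ fun x _ => ?_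
  obtain ⟨C, t, ht, hC⟩ := hf x
  refine ⟨{y | y ∈ interior t ∧ ¬ DifferentiableAt ℝ f y}, ?_, ?_⟩
  · rw [mem_nhdsWithin_iff_exists_mem_nhds_inter]
    exact ⟨interior t, interior_mem_nhds.2 ht, fun y hy => hy⟩
  · have h := (hC.mono interior_subset).ae_differentiableWithinAt_of_mem (μ := μ)
    refine measure_mono_null ?_ h
    rintro y ⟨hy, hd⟩ hd'
    exact hd ((hd' hy).differentiableAt (isOpen_interior.mem_nhds hy))

theorem gradient_mem_clarkeSubgradient [CompleteSpace E] {f : E → ℝ} {x : E}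
    (hx : DifferentiableAt ℝ f x) : gradient f x ∈ clarkeSubgradient f x :=
  subset_closure (subset_convexHull ℝ _
    ⟨fun _ => x, fun _ => hx, tendsto_const_nhds, tendsto_const_nhds⟩)

/-- At a weakly regular value the gradients of `f` on `{f > 0}` are bounded away from zero near
each zero of `f`. -/
theorem IsWeaklyRegularValue.exists_le_norm_gradient [CompleteSpace E] {f : E → ℝ}
    (hf : IsWeaklyRegularValue f 0) {x : E} (hx : f x = 0) :
    ∃ ε > 0, ∀ᶠ y in 𝓝 x, 0 < f y → DifferentiableAt ℝ f y → ε ≤ ‖gradient f y‖ := by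
  by_contra! hcon
  have hseq : ∀ n : ℕ, ∃ y ∈ Metric.ball x (1 / ((n : ℝ) + 1)), 0 < f y ∧
      DifferentiableAt ℝ f y ∧ ‖gradient f y‖ < 1 / ((n : ℝ) + 1) := by
    intro n
    obtain ⟨y, hy, h⟩ := ((hcon (1 / ((n : ℝ) + 1)) Nat.one_div_pos_of_nat).and_eventually
      (Metric.ball_mem_nhds x Nat.one_div_pos_of_nat)).exists
    exact ⟨y, h, hy⟩
  choose y hyx hpos hdiff hgrad using hseq
  have hy : Tendsto y atTop (𝓝 x) := tendsto_iff_dist_tendsto_zero.2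
    (squeeze_zero (fun _ => dist_nonneg) (fun n => (hyx n).le) tendsto_one_div_add_atTop_nhds_zero_nat)
  have hzero : Tendsto (fun n => gradient f (y n)) atTop (𝓝 0) :=
    squeeze_zero_norm (fun n => (hgrad n).le) tendsto_one_div_add_atTop_nhds_zero_nat
  have hlim := hf x y (fun n => gradient f (y n)) hy hpos hx
    fun n => gradient_mem_clarkeSubgradient (hdiff n)
  rw [hzero.enorm.liminf_eq, enorm_zero] at hlim
  exact lt_irrefl _ hlim

theorem norm_gradient_le_of_lipschitzOn [CompleteSpace E] {f : E → ℝ} {x : E} {s : Set E}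
    {C : NNReal} (hs : s ∈ 𝓝 x) (hf : LipschitzOnWith C f s) : ‖gradient f x‖ ≤ C := by
  rw [gradient, LinearIsometryEquiv.norm_map]
  exact norm_fderiv_le_of_lipschitzOn ℝ hs hf

/-- Let `g - h` be nonnegative, vanish at `x`, and have gradients of norm at least `ε` at the points
of `{h < g}` near `x`. If `x` is a limit of such points, limits `p` of `∇ g` and `q` of `∇ h` along
a sequence of them are at distance at least `ε`; and `q`, too, is a subgradient of `g`, since `x`
is a minimum of `g - h`. -/
theorem exists_distant_subgradients [FiniteDimensional ℝ E] {g h : E → ℝ}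
    (hg : ConvexOn ℝ Set.univ g) (hh : ConvexOn ℝ Set.univ h) {x : E} {U : Set E} (hU : IsOpen U)
    (hxU : x ∈ U) {C : NNReal} (hgC : LipschitzOnWith C g U) (hhC : LipschitzOnWith C h U) {ε : ℝ}
    (hε : ∀ y ∈ U, 0 < g y - h y → DifferentiableAt ℝ (fun z => g z - h z) y →
      ε ≤ ‖gradient (fun z => g z - h z) y‖)
    (hnonneg : ∀ y, 0 ≤ g y - h y) (hx : g x - h x = 0)
    (hcl : x ∈ closure {y | 0 < g y - h y}) :
    ∃ p ∈ convexSubdifferential g x, ∃ q ∈ convexSubdifferential g x,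
      ‖p‖ ≤ C ∧ ‖q‖ ≤ C ∧ ε ≤ ‖p - q‖ := by
  let _ : MeasurableSpace E := borel E
  have _ : BorelSpace E := ⟨rfl⟩
  have hgc : Continuous g := hg.locallyLipschitz.continuous
  have hhc : Continuous h := hh.locallyLipschitz.continuous
  have hopen : IsOpen ({y | 0 < g y - h y} ∩ U) :=
    (isOpen_lt continuous_const (hgc.sub hhc)).inter hU
  have hdense : Dense {y | DifferentiableAt ℝ g y ∧ DifferentiableAt ℝ h y} :=
    Measure.dense_of_ae (μ := Measure.addHaar)
      ((hg.locallyLipschitz.ae_differentiableAt _).and (hh.locallyLipschitz.ae_differentiableAt _))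
  have hx' : x ∈ closure (({y | 0 < g y - h y} ∩ U) ∩
      {y | DifferentiableAt ℝ g y ∧ DifferentiableAt ℝ h y}) := by
    exact closure_minimal (hdense.open_subset_closure_inter hopen) isClosed_closure
      (hU.closure_inter ⟨hcl, hxU⟩)
  obtain ⟨y, hy, hyx⟩ := mem_closure_iff_seq_limit.1 hx'
  have hgy : ∀ n, gradient g (y n) ∈ Metric.closedBall (0 : E) C := fun n => by
    simpa using norm_gradient_le_of_lipschitzOn (hU.mem_nhds (hy n).1.2) hgC
  have hhy : ∀ n, gradient h (y n) ∈ Metric.closedBall (0 : E) C := fun n => by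
    simpa using norm_gradient_le_of_lipschitzOn (hU.mem_nhds (hy n).1.2) hhC
  obtain ⟨⟨p, q⟩, ⟨hpC, hqC⟩, σ, hσ, hlim⟩ :=
    ((isCompact_closedBall (0 : E) C).prod (isCompact_closedBall (0 : E) C)).tendsto_subseq
      (x := fun n => (gradient g (y n), gradient h (y n))) fun n => ⟨hgy n, hhy n⟩
  have hp : Tendsto (fun n => gradient g (y (σ n))) atTop (𝓝 p) :=
    (continuous_fst.tendsto _).comp hlim
  have hq : Tendsto (fun n => gradient h (y (σ n))) atTop (𝓝 q) :=
    (continuous_snd.tendsto _).comp hlim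
  have hyσ : Tendsto (fun n => y (σ n)) atTop (𝓝 x) := hyx.comp hσ.tendsto_atTop
  refine ⟨p, mem_convexSubdifferential_of_tendsto hgc.continuousAt hyσ hp fun n =>
      hg.gradient_mem_convexSubdifferential (hy _).2.1, q,
    convexSubdifferential_subset_of_sub_min (fun z => hx.le.trans (hnonneg z))
      (mem_convexSubdifferential_of_tendsto hhc.continuousAt hyσ hq fun n =>
        hh.gradient_mem_convexSubdifferential (hy _).2.2),
    by simpa using hpC, by simpa using hqC, ge_of_tendsto (hp.sub hq).norm
      (Eventually.of_forall fun n => ?_)⟩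
  obtain ⟨⟨hpos, hmem⟩, hdg, hdh⟩ := hy (σ n)
  have hgrad : gradient (fun z => g z - h z) (y (σ n)) =
      gradient g (y (σ n)) - gradient h (y (σ n)) := by
    simp only [gradient, ← map_sub]
    rw [fderiv_fun_sub hdg hdh]
  exact hgrad ▸ hε _ hmem hpos (hdg.sub hdh)

theorem IsWDC.isFinitelyDCCovered_frontier [FiniteDimensional ℝ E] {M : Set E}
    (hM : IsCompact M) (hWDC : IsWDC M) : IsFinitelyDCCovered (frontier M) := by
  obtain ⟨f, ⟨g, h, hg, hh, hf⟩, hnonneg, rfl, hreg⟩ := hWDC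
  obtain rfl : f = fun x => g x - h x := funext hf
  have hcov : IsFinitelyDCCovered
      ((fun x => g x - h x) ⁻¹' {0} ∩ frontier ((fun x => g x - h x) ⁻¹' {0})) := by
    refine hM.induction_on
      (p := fun s => IsFinitelyDCCovered (s ∩ frontier ((fun x => g x - h x) ⁻¹' {0}))) ?_ ?_ ?_ ?_
    · simpa using isFinitelyDCCovered_empty
    · exact fun s t hst ht => ht.mono (Set.inter_subset_inter_left _ hst)
    · exact fun s t hs ht => (hs.union ht).mono (Set.union_inter_distrib_right ..).le
    · intro x₀ hx₀
      obtain ⟨ε, hε, hgrad⟩ := hreg.exists_le_norm_gradient hx₀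
      obtain ⟨C₁, t₁, ht₁, hC₁⟩ := hg.locallyLipschitz x₀
      obtain ⟨C₂, t₂, ht₂, hC₂⟩ := hh.locallyLipschitz x₀
      obtain ⟨U, hUsub, hU, hxU⟩ := mem_nhds_iff.1 (inter_mem (inter_mem ht₁ ht₂) hgrad)
      refine ⟨U, mem_nhdsWithin_of_mem_nhds (hU.mem_nhds hxU),
        (isFinitelyDCCovered_setOf_distant_subgradients g (max C₁ C₂ : NNReal) hε).mono ?_⟩
      rintro x ⟨hx, hfr⟩
      refine exists_distant_subgradients hg hh hU hx
        ((hC₁.mono fun y hy => (hUsub hy).1.1).weaken (le_max_left _ _))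
        ((hC₂.mono fun y hy => (hUsub hy).1.2).weaken (le_max_right _ _))
        (fun y hy => (hUsub hy).2) hnonneg (hM.isClosed.frontier_subset hfr) ?_
      rw [frontier_eq_closure_inter_closure] at hfr
      refine closure_mono (fun y hy => ?_) hfr.2
      exact lt_of_le_of_ne (hnonneg y) (Ne.symm hy)
  exact hcov.mono fun x hx => ⟨hM.isClosed.frontier_subset hx, hx⟩

end DCCovering

theorem proposition6p1 (d : ℕ) (M : Set (EuclideanSpace ℝ (Fin d)))
    (hM : IsCompact M) (hWDC : IsWDC M) :
    ∃ S : Set (Set (EuclideanSpace ℝ (Fin d))),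
      S.Finite ∧ (∀ P ∈ S, IsDCHypersurface P) ∧ frontier M ⊆ ⋃₀ S :=
  hWDC.isFinitelyDCCovered_frontier hM
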